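/- A normal logic program over an infinite set $\mathit{At}$ of atoms is a finite set $P$ of clauses $a\leftarrow b_1,\dots,b_m,\mathbf{not}(c_1),\dots,\mathbf{not}(c_r)$ with $a,b_i,c_j\in \mathit{At}$, where the positive and the negative part of the body are regarded as finite sets of atoms. A set $M\subseteq \mathit{At}$ is a stable model of $P$ if $M$ is the least model of the reduct $P^M$, which is obtained from $P$ by deleting every clause whose body contains $\mathbf{not}(c)$ for some $c\in M$ and then deleting all negative literals from the remaining clauses. Let $s(P)$ be the number of stable models of $P$, let $\mathcal{LP}_n$ be the class of normal logic programs with at most $n$ clauses, and let $s(n)=\max\{s(P): P\in\mathcal{LP}_n\}$. A program $P\in\mathcal{LP}_n$ is extremal in $\mathcal{LP}_n$ if $s(P)=s(n)$. For a finite set $A$ of atoms let $CP[A]$ be the program that consists of the clauses $a\leftarrow \mathbf{not}(b)$, $b\in A\setminus\{a\}$ (one clause, with all these literals in its body, for each $a\in A$). A program $P$ is a $2,3,4$-program with signature $\langle\lambda_2,\lambda_3,\lambda_4\rangle$ if the set of atoms occurring in $P$ can be partitioned into sets $A_1,\dots,A_l$, of which $\lambda_i$ have exactly $i$ elements ($i=2,3,4$)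 and which all have between $2$ and $4$ elements, such that $P=\bigcup_{i} CP[A_i]$. Up to isomorphism (renaming of atoms), let $A(k)$, $C(k)$, $C'(k)$ ($k\ge 1$) and $B(k)$ ($k\ge 0$) be the $2,3,4$-programs with signatures $\langle 0,k,0\rangle$, $\langle 2,k-1,0\rangle$, $\langle 0,k-1,1\rangle$ and $\langle 1,k,0\rangle$, respectively. For a program $P$ let $\overline P$ be the program obtained from $P$ by deleting all negated occurrences of those atoms of $P$ that are not the head of any clause of $P$. Let $\mathcal{E}_n$ be the class of programs $P$ such that $\overline P$ is $A(k)$ if $n=3k$ ($k\ge 1$), $\overline P$ is $C(k)$ or $C'(k)$ if $n=3k+1$ ($k\ge 1$), and $\overline P$ is $B(k)$ if $n=3k+2$ ($k\ge 0$). **Theorem.** For every $n\ge 2$ the maximum $s(n)$ exists and equals $$s_0(n)=\begin{cases}3^{k} & \text{if } n=3k,\\ 4\cdot 3^{k-1} & \text{if } n=3k+1,\\ 2\cdot 3^{k} & \text{if } n=3k+2,\end{cases}$$ and a program $P\in\mathcal{LP}_n$ is extremal in $\mathcal{LP}_n$ if and only if $P\in\mathcal{E}_n$. Consequently, $s(n)=\Theta(3^{n/3})$.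 -/

import Mathlib

namespace LogicProg

/-- A normal clause `head ← pos, not(neg)`: the body consists of the atoms in `pos` and of the
negated atoms `not(c)`, `c ∈ neg`. -/
@[ext]
structure Clause (α : Type*) where
  head : α
  pos : Finset α
  neg : Finset α
deriving DecidableEq

/-- A finite propositional normal logic program over the set `α` of atoms: a finite set of
clauses. -/
abbrev Program (α : Type*) := Finset (Clause α)

/-- The set `N` of atoms satisfies every clause of `Q`. -/
def IsModel {α : Type*} (Q : Set (Clause α)) (N : Set α) : Prop :=
  ∀ c ∈ Q, (∀ b ∈ c.pos, b ∈ N) → (∀ b ∈ c.neg, b ∉ N) → c.head ∈ N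

/-- The Gelfond-Lifschitz reduct of `P` with respect to `M`: clauses with a literal `not(a)`,
`a ∈ M`, are removed, and all negative literals are removed from the other clauses. -/
def reduct {α : Type*} (P : Program α) (M : Set α) : Set (Clause α) :=
  {c | ∃ r ∈ P, (∀ b ∈ r.neg, b ∉ M) ∧ c = ⟨r.head, r.pos, ∅⟩}

/-- `M` is a stable model of `P` if it is the least model of the reduct of `P` with respect
to `M`. -/
def IsStableModel {α : Type*} (P : Program α) (M : Set α) : Prop :=
  IsLeast {N | IsModel (reduct P M) N} M

/-- The family of all stable models of `P`. -/
def stableModels {α : Type*} (P : Program α) : Set (Set α) :=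
  {M | IsStableModel P M}

/-- A stable model is a subset of the (finite) set of heads, so a program has only finitely many
stable models, and counting them by `Set.ncard` is meaningful. -/
theorem finite_stableModels {α : Type*} (P : Program α) : (stableModels P).Finite := by
  have hfin : {a : α | ∃ r ∈ P, r.head = a}.Finite :=
    (P.finite_toSet.image Clause.head).subset (by
      rintro a ⟨r, hr, rfl⟩
      exact ⟨r, hr, rfl⟩)
  refine hfin.finite_subsets.subset ?_
  intro M hM
  refine hM.2 ?_
  rintro c ⟨r, hr, -, rfl⟩ - -
  exact ⟨r, hr, rfl⟩

/-- The number `s(P)` of stable models of `P`. -/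
noncomputable def numStable {α : Type*} (P : Program α) : ℕ :=
  (stableModels P).ncard

/-- The class of normal logic programs over `α` with at most `n` clauses. -/
def LP (α : Type*) (n : ℕ) : Set (Program α) :=
  {P | P.card ≤ n}

/-- `s(n)`, the maximum of `s(P)` over all programs `P` with at most `n` clauses. -/
noncomputable def maxStable (α : Type*) (n : ℕ) : ℕ :=
  sSup (numStable '' LP α n)

/-- `P` is an extremal program of the class `LP α n`. -/
def IsExtremal {α : Type*} (n : ℕ) (P : Program α) : Prop :=
  P ∈ LP α n ∧ ∀ Q ∈ LP α n, numStable Q ≤ numStable P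

/-- The function `s₀`, used for `n ≥ 2` only. -/
def s0 (n : ℕ) : ℕ :=
  if n % 3 = 0 then 3 ^ (n / 3)
  else if n % 3 = 1 then 4 * 3 ^ (n / 3 - 1)
  else 2 * 3 ^ (n / 3)

section

variable {α : Type*} [DecidableEq α]

/-- The set of heads of clauses of `P`. -/
def heads (P : Program α) : Finset α :=
  P.image Clause.head

/-- The set of atoms that occur in `P`. -/
def atoms (P : Program α) : Finset α :=
  P.biUnion fun r => insert r.head (r.pos ∪ r.neg)

/-- The redundant atoms of `P`: those that occur in `P` but are not the head of a clause. -/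
def redundantAtoms (P : Program α) : Finset α :=
  atoms P \ heads P

/-- The program obtained from `P` by removing all negated occurrences of redundant atoms. -/
def overline (P : Program α) : Program α :=
  P.image fun r => ⟨r.head, r.pos, r.neg \ redundantAtoms P⟩

/-- The canonical program `CP[A]`: all clauses `a ← not(b), b ∈ A \ {a}` with `a ∈ A`. -/
def canonical (A : Finset α) : Program α :=
  A.image fun a => ⟨a, ∅, A.erase a⟩

/-- `P` is a 2,3,4-program with signature `⟨l2, l3, l4⟩`: the set of atoms of `P` has a partition
into parts with 2, 3 or 4 elements such that `P` is the union of the canonical programs over the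
parts, and there are `l2`, `l3`, `l4` parts with 2, 3, 4 elements. -/
def HasSignature (P : Program α) (l2 l3 l4 : ℕ) : Prop :=
  ∃ S : Finpartition (atoms P),
    (∀ A ∈ S.parts, 2 ≤ A.card ∧ A.card ≤ 4) ∧
    P = S.parts.biUnion canonical ∧
    (S.parts.filter fun A => A.card = 2).card = l2 ∧
    (S.parts.filter fun A => A.card = 3).card = l3 ∧
    (S.parts.filter fun A => A.card = 4).card = l4

/-- `P` is (up to isomorphism) the program `A(k)`, `k ≥ 1`. -/
def IsA (k : ℕ) (P : Program α) : Prop := HasSignature P 0 k 0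

/-- `P` is (up to isomorphism) the program `B(k)`, `k ≥ 0`. -/
def IsB (k : ℕ) (P : Program α) : Prop := HasSignature P 1 k 0

/-- `P` is (up to isomorphism) the program `C(k)`, `k ≥ 1`. -/
def IsC (k : ℕ) (P : Program α) : Prop := HasSignature P 2 (k - 1) 0

/-- `P` is (up to isomorphism) the program `C'(k)`, `k ≥ 1`. -/
def IsC' (k : ℕ) (P : Program α) : Prop := HasSignature P 0 (k - 1) 1

/-- The class of programs `P` for which `overline P` is `A(k)` if `n = 3k` (`k ≥ 1`), is `B(k)` if
`n = 3k + 2` (`k ≥ 0`), and is `C(k)` or `C'(k)` if `n = 3k + 1` (`k ≥ 1`). -/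
def classE (α : Type*) [DecidableEq α] (n : ℕ) : Set (Program α) :=
  {P | (∃ k, 1 ≤ k ∧ n = 3 * k ∧ IsA k (overline P)) ∨
    (∃ k, n = 3 * k + 2 ∧ IsB k (overline P)) ∨
    (∃ k, 1 ≤ k ∧ n = 3 * k + 1 ∧ (IsC k (overline P) ∨ IsC' k (overline P)))}

end

end LogicProg

namespace LogicProg

/-! Make the clauses of `P` the vertices of a graph, joining two clauses when the head of one is
negated in the body of the other. The clauses applied in a stable model form an independent set, and
two stable models whose applied clauses lie in one common independent set are equal
(`IsStableModel.eq_of_generating_subset`). Extending each set of applied clauses to a maximal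
independent set is therefore injective, and the Moon-Moser bound `card_maxIndeps_le` gives the upper
bound. Disjoint blocks `CP[A]` attain it: picking one atom per block always gives a stable model.

If a program attains the bound, equality holds throughout the Moon-Moser induction, so its conflict
graph is a disjoint union of cliques of size 2, 3 or 4, and every maximal independent set is exactly
the set of applied clauses of a stable model (`IsTight`). Exchanging one clause for another of its
clique then forces distinct heads, empty positive bodies, and negation of all other heads of the
clique and of no further heads. What remains are negated atoms that head no clause; they never
matter, and `overline` removes them. Comparing products of twos, threes and fours leaves the
signatures of `classE`. -/

/-! ### Arithmetic of the Moon-Moser numbers -/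

/-- The maximum number of maximal independent sets of a graph with `n` vertices. -/
def moonMoser : ℕ → ℕ
  | 0 => 1
  | 1 => 1
  | 2 => 2
  | 3 => 3
  | 4 => 4
  -- The recursion starts only at 5, since the value 4 at 4 exceeds three times the value at 1.
  | n + 5 => 3 * moonMoser (n + 2)

theorem moonMoser_pos : ∀ n, 0 < moonMoser n
  | 0 | 1 | 2 | 3 | 4 => by decide
  | n + 5 => by
    have := moonMoser_pos (n + 2)
    rw [moonMoser]; omega

/-- Strictness fails only at the bottom, where the values at 0 and 1 agree. -/
theorem moonMoser_lt_succ : ∀ n, 1 ≤ n → moonMoser n < moonMoser (n + 1)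
  | 0, h => by omega
  | 1, _ | 2, _ | 3, _ | 4, _ => by decide
  | n + 5, _ => by
    have := moonMoser_lt_succ (n + 2) (by omega)
    rw [show n + 5 + 1 = (n + 1) + 5 by ring, moonMoser, moonMoser]
    rw [show n + 1 + 2 = n + 2 + 1 by ring]; omega

theorem moonMoser_mono : Monotone moonMoser := by
  refine monotone_nat_of_le_succ fun n => ?_
  rcases Nat.eq_zero_or_pos n with rfl | h
  · decide
  · exact (moonMoser_lt_succ n h).le

theorem moonMoser_lt {m n : ℕ} (h : m < n) (hn : 2 ≤ n) : moonMoser m < moonMoser n := by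
  obtain ⟨k, rfl⟩ := Nat.exists_eq_add_of_le' hn
  exact (moonMoser_mono (show m ≤ k + 1 by omega)).trans_lt (moonMoser_lt_succ (k + 1) (by omega))

theorem two_mul_moonMoser_le : ∀ k, 2 * moonMoser k ≤ moonMoser (k + 2)
  | 0 | 1 | 2 | 3 | 4 => by decide
  | n + 5 => by
    have := two_mul_moonMoser_le (n + 2)
    rw [show n + 5 + 2 = (n + 2) + 5 by ring, moonMoser, moonMoser]; omega

theorem three_mul_moonMoser_le : ∀ k, 3 * moonMoser k ≤ moonMoser (k + 3)
  | 0 | 1 => by decide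
  | n + 2 => le_rfl

theorem four_mul_moonMoser_le : ∀ k, 4 * moonMoser k ≤ moonMoser (k + 4)
  | 0 | 1 | 2 | 3 | 4 => by decide
  | n + 5 => by
    have := four_mul_moonMoser_le (n + 2)
    rw [show n + 5 + 4 = (n + 4) + 5 by ring, moonMoser, moonMoser,
      show n + 4 + 2 = n + 2 + 4 by ring]; omega

/-- This is the inductive step of the Moon-Moser bound, with `m` the size of a smallest closed
neighbourhood. A factor of at least 5 can be lowered by 3 at the price of a factor 3, because `m + 5
≤ 3 * (m + 2)`. -/
theorem mul_moonMoser_le : ∀ m k, m * moonMoser k ≤ moonMoser (k + m)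
  | 0, k => by simp
  | 1, k => by simpa using moonMoser_mono (Nat.le_succ k)
  | 2, k => two_mul_moonMoser_le k
  | 3, k => three_mul_moonMoser_le k
  | 4, k => four_mul_moonMoser_le k
  | m + 5, k => by
    have h1 := mul_moonMoser_le (m + 2) k
    have h2 := three_mul_moonMoser_le (k + (m + 2))
    rw [show k + (m + 5) = k + (m + 2) + 3 by ring]
    nlinarith [moonMoser_pos k]

theorem mul_moonMoser_lt {m k : ℕ} (hm : 5 ≤ m) : m * moonMoser k < moonMoser (k + m) := by
  obtain ⟨m, rfl⟩ := Nat.exists_eq_add_of_le' hm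
  have h1 := mul_moonMoser_le (m + 2) k
  have h2 := three_mul_moonMoser_le (k + (m + 2))
  rw [show k + (m + 5) = k + (m + 2) + 3 by ring]
  nlinarith [moonMoser_pos k]

/-- Equality in `mul_moonMoser_le`. -/
theorem of_mul_moonMoser_eq {m k : ℕ} (hm : 1 ≤ m) (hmk : m + k ≠ 1)
    (h : m * moonMoser k = moonMoser (k + m)) : 2 ≤ m ∧ m ≤ 4 ∧ k ≠ 1 := by
  have h4 : m ≤ 4 := by
    by_contra! h5
    exact (mul_moonMoser_lt h5).ne h
  have h2 : 2 ≤ m := by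
    by_contra! h1
    obtain rfl : m = 1 := by omega
    rw [one_mul] at h
    exact (moonMoser_lt_succ k (by omega)).ne h
  -- Excluding `k = 1` lets the structural induction continue on the remaining `k` vertices: a
  -- single vertex attains the bound but has no neighbour.
  refine ⟨h2, h4, ?_⟩
  rintro rfl
  interval_cases m <;> revert h <;> decide

theorem moonMoser_eq_s0 : ∀ n, 2 ≤ n → moonMoser n = s0 n
  | 0, h | 1, h => by omega
  | 2, _ | 3, _ | 4, _ => by decide
  | n + 5, _ => by
    rw [moonMoser, moonMoser_eq_s0 (n + 2) (by omega)]
    have h1 : (n + 5) / 3 = (n + 2) / 3 + 1 := by omega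
    have h2 : (n + 5) % 3 = (n + 2) % 3 := by omega
    unfold s0
    rw [h1, h2]
    split_ifs with h3 h4
    · ring
    · obtain ⟨j, hj⟩ : ∃ j, (n + 2) / 3 = j + 1 := ⟨(n + 2) / 3 - 1, by omega⟩
      rw [hj]; simp only [Nat.add_sub_cancel]; ring
    · ring

theorem pow_mul_moonMoser_le {m k : ℕ} (j : ℕ) :
    m ^ j * moonMoser k ≤ moonMoser (k + j * m) := by
  induction j with
  | zero => simp
  | succ j ih =>
    calc m ^ (j + 1) * moonMoser k = m * (m ^ j * moonMoser k) := by ring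
      _ ≤ m * moonMoser (k + j * m) := Nat.mul_le_mul_left _ ih
      _ ≤ moonMoser (k + j * m + m) := mul_moonMoser_le _ _
      _ = _ := by congr 1; ring

theorem pow_mul_pow_mul_pow_le (a b c : ℕ) :
    2 ^ a * 3 ^ b * 4 ^ c ≤ moonMoser (2 * a + 3 * b + 4 * c) := by
  have h1 := pow_mul_moonMoser_le (m := 4) (k := 0) c
  have h2 := pow_mul_moonMoser_le (m := 3) (k := 0 + c * 4) b
  have h3 := pow_mul_moonMoser_le (m := 2) (k := 0 + c * 4 + b * 3) a
  rw [show 2 * a + 3 * b + 4 * c = 0 + c * 4 + b * 3 + a * 2 by ring]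
  refine le_trans ?_ h3
  rw [mul_assoc]
  refine Nat.mul_le_mul_left _ (le_trans (Nat.mul_le_mul_left _ ?_) h2)
  simpa [moonMoser] using h1

/-- A product of twos, threes and fours is extremal only if it is a product of threes, apart from
at most one factor four or two factors two. -/
theorem add_le_two_of_pow_mul_eq {a b c : ℕ}
    (h : 2 ^ a * 3 ^ b * 4 ^ c = moonMoser (2 * a + 3 * b + 4 * c)) : a + 2 * c ≤ 2 := by
  have key : ∀ a' b' c', 2 * a' + 3 * b' + 4 * c' = 2 * a + 3 * b + 4 * c →
      2 ^ a' * 3 ^ b' * 4 ^ c' ≤ 2 ^ a * 3 ^ b * 4 ^ c := by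
    intro a' b' c' e
    rw [h, ← e]
    exact pow_mul_pow_mul_pow_le a' b' c'
  by_contra! hac
  -- Each case has an exchange that keeps the sum and increases the product: 2·2·2 < 3·3, 2·4 < 3·3
  -- and 4·4 < 2·3·3.
  have hcases : 3 ≤ a ∨ (1 ≤ a ∧ 1 ≤ c) ∨ 2 ≤ c := by omega
  rcases hcases with h3 | ⟨h1, h2⟩ | h2
  · obtain ⟨a, rfl⟩ := Nat.exists_eq_add_of_le' h3
    have := key a (b + 2) c (by ring)
    have hp : 0 < 2 ^ a * 3 ^ b * 4 ^ c := by positivity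
    ring_nf at this hp
    omega
  · obtain ⟨a, rfl⟩ := Nat.exists_eq_add_of_le' h1
    obtain ⟨c, rfl⟩ := Nat.exists_eq_add_of_le' h2
    have := key a (b + 2) c (by ring)
    have hp : 0 < 2 ^ a * 3 ^ b * 4 ^ c := by positivity
    ring_nf at this hp
    omega
  · obtain ⟨c, rfl⟩ := Nat.exists_eq_add_of_le' h2
    have := key (a + 1) (b + 2) c (by ring)
    have hp : 0 < 2 ^ a * 3 ^ b * 4 ^ c := by positivity
    ring_nf at this hp
    omega

/-! ### Maximal independent sets and the extremal graphs -/

section Graph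

/-- `I` is a maximal independent set of the subgraph of `G` induced by `W`. -/
def IsMaxIndep {V : Type*} (G : SimpleGraph V) (W I : Finset V) : Prop :=
  I ⊆ W ∧ (∀ x ∈ I, ∀ y ∈ I, ¬ G.Adj x y) ∧ ∀ x ∈ W, x ∉ I → ∃ y ∈ I, G.Adj x y

open Classical in
/-- The family of the maximal independent sets of the subgraph of `G` induced by `W`. -/
noncomputable def maxIndeps {V : Type*} (G : SimpleGraph V) (W : Finset V) : Finset (Finset V) :=
  W.powerset.filter (IsMaxIndep G W)

theorem mem_maxIndeps {V : Type*} {G : SimpleGraph V} {W I : Finset V} :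
    I ∈ maxIndeps G W ↔ IsMaxIndep G W I := by
  simp only [maxIndeps, Finset.mem_filter, Finset.mem_powerset]
  exact ⟨fun h => h.2, fun h => ⟨h.1, h⟩⟩

variable {V : Type*} [DecidableEq V]

theorem exists_isMaxIndep_superset {G : SimpleGraph V} {W I : Finset V} (hI : I ⊆ W)
    (hind : ∀ x ∈ I, ∀ y ∈ I, ¬ G.Adj x y) : ∃ J, IsMaxIndep G W J ∧ I ⊆ J := by
  classical
  obtain ⟨J, hIJ, hJ⟩ := (W.powerset.filter
    fun J => ∀ x ∈ J, ∀ y ∈ J, ¬ G.Adj x y).exists_le_maximal (a := I) (by simp [hI]; exact hind)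
  simp only [Finset.mem_filter, Finset.mem_powerset] at hJ
  refine ⟨J, ⟨hJ.prop.1, hJ.prop.2, fun x hx hxJ => ?_⟩, hIJ⟩
  by_contra! hno
  refine hxJ (hJ.le_of_ge (y := insert x J) ⟨?_, ?_⟩ (Finset.subset_insert _ _)
    (Finset.mem_insert_self _ _))
  · exact Finset.insert_subset hx hJ.prop.1
  · intro y hy z hz
    rcases Finset.mem_insert.1 hy with rfl | hy' <;> rcases Finset.mem_insert.1 hz with rfl | hz'
    · exact G.irrefl
    · exact hno z hz'
    · exact fun h => hno y hy' h.symm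
    · exact hJ.prop.2 y hy' z hz'

/-- The closed neighbourhood of `u` in the subgraph of `G` induced by `W`. -/
def closedNbhd (G : SimpleGraph V) [DecidableRel G.Adj] (W : Finset V) (u : V) : Finset V :=
  W.filter fun x => x = u ∨ G.Adj u x

variable {G : SimpleGraph V} [DecidableRel G.Adj]

theorem mem_closedNbhd {W : Finset V} {u x : V} :
    x ∈ closedNbhd G W u ↔ x ∈ W ∧ (x = u ∨ G.Adj u x) := by
  simp [closedNbhd]

theorem self_mem_closedNbhd {W : Finset V} {u : V} (hu : u ∈ W) : u ∈ closedNbhd G W u :=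
  mem_closedNbhd.2 ⟨hu, Or.inl rfl⟩

/-- Erasing `u` is injective on sets containing `u`, and maximality survives: a vertex outside the
closed neighbourhood of `u` must be dominated by some other vertex. -/
theorem card_filter_mem_maxIndeps_le (W : Finset V) (u : V) :
    ((maxIndeps G W).filter fun I => u ∈ I).card ≤
      (maxIndeps G (W \ closedNbhd G W u)).card := by
  refine Finset.card_le_card_of_injOn (fun I => I.erase u) ?_ ?_
  · intro I hI
    rw [Finset.mem_coe, Finset.mem_filter, mem_maxIndeps] at hI
    obtain ⟨⟨hIW, hind, hmax⟩, hu⟩ := hI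
    rw [Finset.mem_coe, mem_maxIndeps]
    refine ⟨fun x hx => ?_, fun x hx y hy => ?_, fun x hx hxI => ?_⟩
    · rw [Finset.mem_erase] at hx
      rw [Finset.mem_sdiff, mem_closedNbhd]
      exact ⟨hIW hx.2, fun h => h.2.elim hx.1 (hind u hu x hx.2)⟩
    · exact hind x (Finset.mem_of_mem_erase hx) y (Finset.mem_of_mem_erase hy)
    · rw [Finset.mem_sdiff, mem_closedNbhd] at hx
      have hxu : x ≠ u := fun h => hx.2 ⟨hx.1, Or.inl h⟩
      obtain ⟨y, hy, hxy⟩ := hmax x hx.1 fun h => hxI (Finset.mem_erase.2 ⟨hxu, h⟩)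
      refine ⟨y, Finset.mem_erase.2 ⟨?_, hy⟩, hxy⟩
      rintro rfl
      exact hx.2 ⟨hx.1, Or.inr hxy.symm⟩
  · intro I hI J hJ h
    simp only [Finset.coe_filter, Set.mem_ofPred_eq] at hI hJ
    rw [← Finset.insert_erase hI.2, ← Finset.insert_erase hJ.2, show I.erase u = J.erase u from h]

theorem sum_card_inter_closedNbhd (W : Finset V) (v : V) :
    ∑ I ∈ maxIndeps G W, (closedNbhd G W v ∩ I).card =
      ∑ u ∈ closedNbhd G W v, ((maxIndeps G W).filter fun I => u ∈ I).card := by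
  have := Finset.sum_card_bipartiteAbove_eq_sum_card_bipartiteBelow (s := maxIndeps G W)
    (t := closedNbhd G W v) (fun I u => u ∈ I)
  simpa only [Finset.bipartiteAbove, Finset.bipartiteBelow, Finset.filter_mem_eq_inter] using this

theorem one_le_card_inter_closedNbhd {W I : Finset V} {v : V} (hv : v ∈ W)
    (hI : I ∈ maxIndeps G W) : 1 ≤ (closedNbhd G W v ∩ I).card := by
  obtain ⟨hIW, hind, hmax⟩ := mem_maxIndeps.1 hI
  rw [Nat.one_le_iff_ne_zero, Finset.card_ne_zero]
  by_cases h : v ∈ I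
  · exact ⟨v, Finset.mem_inter.2 ⟨self_mem_closedNbhd hv, h⟩⟩
  · obtain ⟨y, hy, hvy⟩ := hmax v hv h
    exact ⟨y, Finset.mem_inter.2 ⟨mem_closedNbhd.2 ⟨hIW hy, Or.inr hvy⟩, hy⟩⟩

theorem card_maxIndeps_le_sum {W : Finset V} {v : V} (hv : v ∈ W) :
    (maxIndeps G W).card ≤
      ∑ u ∈ closedNbhd G W v, ((maxIndeps G W).filter fun I => u ∈ I).card := by
  rw [← sum_card_inter_closedNbhd, Finset.card_eq_sum_ones]
  exact Finset.sum_le_sum fun I hI => one_le_card_inter_closedNbhd hv hI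

theorem card_sdiff_closedNbhd (W : Finset V) (u : V) :
    (W \ closedNbhd G W u).card = W.card - (closedNbhd G W u).card :=
  Finset.card_sdiff_of_subset (Finset.filter_subset _ _)

/-- The Moon-Moser bound: a graph with `n` vertices has at most `moonMoser n` maximal independent
sets. -/
theorem card_maxIndeps_le (W : Finset V) : (maxIndeps G W).card ≤ moonMoser W.card := by
  induction hn : W.card using Nat.strong_induction_on generalizing W with
  | _ n ih =>
  subst hn
  rcases W.eq_empty_or_nonempty with rfl | hW
  · exact Finset.card_le_card (t := {∅}) fun I hI => by
      simpa using (mem_maxIndeps.1 hI).1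
  -- With `v` of minimum degree, every `u` in its closed neighbourhood removes at least as many
  -- vertices as `v`, so one bound serves all summands.
  obtain ⟨v, hv, hmin⟩ := W.exists_min_image (fun u => (closedNbhd G W u).card) hW
  have hle : (closedNbhd G W v).card ≤ W.card := Finset.card_le_card (Finset.filter_subset _ _)
  have hpos : ∀ u ∈ W, 0 < (closedNbhd G W u).card := fun u hu =>
    Finset.card_pos.2 ⟨u, self_mem_closedNbhd hu⟩
  have hv0 := hpos v hv
  calc (maxIndeps G W).card
      ≤ ∑ u ∈ closedNbhd G W v, ((maxIndeps G W).filter fun I => u ∈ I).card :=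
        card_maxIndeps_le_sum hv
    _ ≤ ∑ _u ∈ closedNbhd G W v, moonMoser (W.card - (closedNbhd G W v).card) := by
        refine Finset.sum_le_sum fun u hu => ?_
        have huW := (mem_closedNbhd.1 hu).1
        refine (card_filter_mem_maxIndeps_le W u).trans ((ih _ ?_ _ rfl).trans ?_)
        · rw [card_sdiff_closedNbhd]
          have := hpos u huW; omega
        · rw [card_sdiff_closedNbhd]
          exact moonMoser_mono (Nat.sub_le_sub_left (hmin u huW) _)
    _ = (closedNbhd G W v).card * moonMoser (W.card - (closedNbhd G W v).card) := by simp
    _ ≤ moonMoser W.card := by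
        have := mul_moonMoser_le (closedNbhd G W v).card (W.card - (closedNbhd G W v).card)
        rwa [Nat.sub_add_cancel hle] at this

/-- `S` is the family of the vertex sets of the components of the subgraph of `G` induced by `W`,
and these components are complete. -/
structure IsClusterFamily (G : SimpleGraph V) (W : Finset V) (S : Finset (Finset V)) : Prop where
  disj : ∀ A ∈ S, ∀ B ∈ S, A ≠ B → Disjoint A B
  mem_iff : ∀ x, x ∈ W ↔ ∃ A ∈ S, x ∈ A
  adj_iff : ∀ x ∈ W, ∀ y ∈ W, G.Adj x y ↔ x ≠ y ∧ ∃ A ∈ S, x ∈ A ∧ y ∈ A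

theorem IsClusterFamily.insert {G : SimpleGraph V} {W C : Finset V} {S : Finset (Finset V)}
    (hS : IsClusterFamily G (W \ C) S) (hCW : C ⊆ W)
    (hC : ∀ x ∈ C, ∀ y ∈ W, G.Adj x y ↔ x ≠ y ∧ y ∈ C) :
    IsClusterFamily G W (insert C S) := by
  have hd : ∀ A ∈ S, Disjoint C A := by
    intro A hA
    rw [Finset.disjoint_left]
    intro x hxC hxA
    exact (Finset.mem_sdiff.1 ((hS.mem_iff x).2 ⟨A, hA, hxA⟩)).2 hxC
  refine ⟨?_, ?_, ?_⟩
  · intro A hA B hB hAB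
    rcases Finset.mem_insert.1 hA with rfl | hA' <;> rcases Finset.mem_insert.1 hB with rfl | hB'
    · exact absurd rfl hAB
    · exact hd B hB'
    · exact (hd A hA').symm
    · exact hS.disj A hA' B hB' hAB
  · intro x
    rw [Finset.exists_mem_insert, ← hS.mem_iff, Finset.mem_sdiff]
    by_cases h : x ∈ C
    · simp [h, hCW h]
    · simp [h]
  · intro x hx y hy
    rw [Finset.exists_mem_insert]
    by_cases hxC : x ∈ C
    · rw [hC x hxC y hy]
      refine and_congr_right fun _ => ⟨fun h => Or.inl ⟨hxC, h⟩, ?_⟩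
      rintro (h | ⟨A, hA, hxA, -⟩)
      · exact h.2
      · exact absurd hxA (Finset.disjoint_left.1 (hd A hA) hxC)
    · by_cases hyC : y ∈ C
      · rw [G.adj_comm, hC y hyC x hx]
        simp only [hxC, and_false, false_and, false_or, false_iff, not_and, not_exists]
        intro _ A hA _ hyA
        exact Finset.disjoint_left.1 (hd A hA) hyC hyA
      · rw [hS.adj_iff x (Finset.mem_sdiff.2 ⟨hx, hxC⟩) y (Finset.mem_sdiff.2 ⟨hy, hyC⟩)]
        simp [hxC]

/-- The extremal graphs for the Moon-Moser bound are disjoint unions of complete graphs. -/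
theorem exists_isClusterFamily_of_card_maxIndeps_eq (W : Finset V) (h1 : W.card ≠ 1)
    (h : (maxIndeps G W).card = moonMoser W.card) :
    ∃ S, IsClusterFamily G W S ∧ (∀ A ∈ S, 2 ≤ A.card ∧ A.card ≤ 4) ∧
      ∏ A ∈ S, A.card = moonMoser W.card := by
  induction hn : W.card using Nat.strong_induction_on generalizing W with
  | _ n ih =>
  subst hn
  rcases W.eq_empty_or_nonempty with rfl | hW
  · exact ⟨∅, ⟨by simp, by simp, by simp⟩, by simp, by simp [moonMoser]⟩
  obtain ⟨v, hv, hmin⟩ := W.exists_min_image (fun u => (closedNbhd G W u).card) hW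
  set C := closedNbhd G W v with hCdef
  have hCW : C ⊆ W := Finset.filter_subset _ _
  have hle : C.card ≤ W.card := Finset.card_le_card hCW
  have hpos : 0 < C.card := Finset.card_pos.2 ⟨v, self_mem_closedNbhd hv⟩
  have hterm : ∀ u ∈ C, ((maxIndeps G W).filter fun I => u ∈ I).card ≤
      moonMoser (W.card - C.card) := by
    intro u hu
    refine (card_filter_mem_maxIndeps_le W u).trans ((card_maxIndeps_le _).trans ?_)
    rw [card_sdiff_closedNbhd]
    exact moonMoser_mono (Nat.sub_le_sub_left (hmin u (hCW hu)) _)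
  have hsum := Finset.sum_le_sum hterm
  have hbound := mul_moonMoser_le C.card (W.card - C.card)
  rw [Nat.sub_add_cancel hle] at hbound
  have hcard := card_maxIndeps_le_sum (G := G) hv
  have hconst : ∑ _u ∈ C, moonMoser (W.card - C.card) =
      C.card * moonMoser (W.card - C.card) := by simp
  rw [hconst] at hsum
  -- The upper bound is attained, so each inequality of the counting argument is an equality, also
  -- term by term.
  have heq : C.card * moonMoser (W.card - C.card) = moonMoser W.card :=
    le_antisymm hbound (by rw [← h]; exact hcard.trans hsum)
  have hsumeq : ∑ u ∈ C, ((maxIndeps G W).filter fun I => u ∈ I).card =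
      ∑ _u ∈ C, moonMoser (W.card - C.card) := by
    rw [hconst, heq]
    exact le_antisymm (hsum.trans heq.le) (h ▸ hcard)
  have hteq := (Finset.sum_eq_sum_iff_of_le hterm).1 hsumeq
  obtain ⟨h2, h4, hne⟩ := of_mul_moonMoser_eq (m := C.card) (k := W.card - C.card) hpos
    (by omega) (by rw [Nat.sub_add_cancel hle]; exact heq)
  have hone : ∀ I ∈ maxIndeps G W, 1 = (C ∩ I).card := by
    refine (Finset.sum_eq_sum_iff_of_le fun I hI => one_le_card_inter_closedNbhd hv hI).1 ?_
    rw [sum_card_inter_closedNbhd, ← Finset.card_eq_sum_ones, h, hsumeq, hconst, heq]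
  -- Two nonadjacent vertices of `C` would extend to a maximal independent set meeting `C` twice,
  -- contrary to `hone`.
  have hclique : ∀ x ∈ C, ∀ y ∈ C, x ≠ y → G.Adj x y := by
    intro x hx y hy hxy
    by_contra hna
    obtain ⟨J, hJ, hsub⟩ := exists_isMaxIndep_superset (G := G) (W := W) (I := {x, y})
      (by simp [Finset.insert_subset_iff, hCW hx, hCW hy]) (by
        simp [hna, G.adj_comm y x])
    have h2J : ({x, y} : Finset V).card ≤ (C ∩ J).card :=
      Finset.card_le_card (Finset.subset_inter (by simp [Finset.insert_subset_iff, hx, hy]) hsub)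
    rw [← hone J (mem_maxIndeps.2 hJ), Finset.card_pair hxy] at h2J
    omega
  -- A neighbour of `x` outside `C` would leave fewer vertices, hence strictly fewer maximal
  -- independent sets through `x` than `hteq` demands.
  have hnb : ∀ x ∈ C, closedNbhd G W x = C := by
    intro x hx
    refine (Finset.eq_of_subset_of_card_le (fun y hy => ?_) ?_).symm
    · refine mem_closedNbhd.2 ⟨hCW hy, ?_⟩
      by_cases hyx : y = x
      · exact Or.inl hyx
      · exact Or.inr (hclique x hx y hy (Ne.symm hyx))
    · by_contra! hlt
      have hW' : (closedNbhd G W x).card ≤ W.card :=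
        Finset.card_le_card (Finset.filter_subset _ _)
      have h3 := (card_filter_mem_maxIndeps_le (G := G) W x).trans (card_maxIndeps_le _)
      rw [card_sdiff_closedNbhd, hteq x hx] at h3
      exact absurd h3 (not_le.2 (moonMoser_lt (by omega) (by omega)))
  have hsd : (W \ C).card = W.card - C.card := card_sdiff_closedNbhd W v
  have hrec : (maxIndeps G (W \ C)).card = moonMoser (W \ C).card := by
    refine le_antisymm (card_maxIndeps_le _) ?_
    rw [hsd, ← hteq v (self_mem_closedNbhd hv)]
    exact card_filter_mem_maxIndeps_le W v
  obtain ⟨S, hS, hS2, hS3⟩ := ih _ (by rw [hsd]; omega) (W \ C) (by rw [hsd]; exact hne) hrec rfl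
  refine ⟨insert C S, hS.insert hCW ?_, ?_, ?_⟩
  · intro x hx y hy
    rw [← hnb x hx, mem_closedNbhd]
    constructor
    · exact fun hxy => ⟨hxy.ne, hy, Or.inr hxy⟩
    · rintro ⟨hxy, -, h | h⟩
      · exact absurd h.symm hxy
      · exact h
  · intro A hA
    rcases Finset.mem_insert.1 hA with rfl | hA
    · exact ⟨h2, h4⟩
    · exact hS2 A hA
  · rw [Finset.prod_insert, hS3, hsd, heq]
    intro hCS
    have hvC : v ∈ C := self_mem_closedNbhd hv
    exact (Finset.mem_sdiff.1 ((hS.mem_iff v).2 ⟨C, hCS, hvC⟩)).2 hvC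

end Graph

/-! ### Stable models and the conflict graph -/

section StableModels

variable {α : Type*}

theorem isModel_reduct {P : Program α} {M N : Set α} :
    IsModel (reduct P M) N ↔
      ∀ r ∈ P, (∀ c ∈ r.neg, c ∉ M) → (∀ b ∈ r.pos, b ∈ N) → r.head ∈ N := by
  constructor
  · intro h r hr hneg hpos
    exact h ⟨r.head, r.pos, ∅⟩ ⟨r, hr, hneg, rfl⟩ hpos (by simp)
  · rintro h _ ⟨r, hr, hneg, rfl⟩ hpos -
    exact h r hr hneg hpos

theorem isStableModel_iff {P : Program α} {M : Set α} :
    IsStableModel P M ↔ IsModel (reduct P M) M ∧ ∀ N, IsModel (reduct P M) N → M ⊆ N :=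
  Iff.rfl

/-- A larger set deletes more clauses, so the smaller stable model still satisfies the reduct of the
larger one. -/
theorem IsStableModel.eq_of_subset {P : Program α} {M N : Set α} (hM : IsStableModel P M)
    (hN : IsStableModel P N) (h : N ⊆ M) : N = M := by
  refine h.antisymm (hM.2 (isModel_reduct.2 fun r hr hneg => ?_))
  exact isModel_reduct.1 hN.1 r hr fun c hc hcN => hneg c hc (h hcN)

open Classical in
/-- The clauses of `P` that are applied in `M`. -/
noncomputable def generating (P : Program α) (M : Set α) : Program α :=
  P.filter fun r => (∀ b ∈ r.pos, b ∈ M) ∧ ∀ c ∈ r.neg, c ∉ M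

theorem mem_generating {P : Program α} {M : Set α} {r : Clause α} :
    r ∈ generating P M ↔ r ∈ P ∧ (∀ b ∈ r.pos, b ∈ M) ∧ ∀ c ∈ r.neg, c ∉ M := by
  simp [generating]

theorem generating_subset (P : Program α) (M : Set α) : generating P M ⊆ P := fun _ h =>
  (mem_generating.1 h).1

theorem IsStableModel.mem_iff {P : Program α} {M : Set α} (hM : IsStableModel P M) (a : α) :
    a ∈ M ↔ ∃ r ∈ generating P M, r.head = a := by
  constructor
  · have hmod : ∀ r ∈ generating P M, r.head ∈ M := fun r hr =>
      isModel_reduct.1 hM.1 r (mem_generating.1 hr).1 (mem_generating.1 hr).2.2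
        (mem_generating.1 hr).2.1
    have hN : IsModel (reduct P M) {a | ∃ r ∈ generating P M, r.head = a} := by
      refine isModel_reduct.2 fun r hr hneg hpos => ⟨r, mem_generating.2 ⟨hr, ?_, hneg⟩, rfl⟩
      intro b hb
      obtain ⟨s, hs, rfl⟩ := hpos b hb
      exact hmod s hs
    exact fun ha => hM.2 hN ha
  · rintro ⟨r, hr, rfl⟩
    rw [mem_generating] at hr
    exact isModel_reduct.1 hM.1 r hr.1 hr.2.2 hr.2.1

variable (α) in
/-- Two different clauses are in conflict if the head of one of them occurs negated in the body of
the other one. -/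
def conflictGraph : SimpleGraph (Clause α) where
  Adj r s := r ≠ s ∧ (r.head ∈ s.neg ∨ s.head ∈ r.neg)
  symm := ⟨fun _ _ h => ⟨h.1.symm, h.2.symm⟩⟩
  loopless := ⟨fun _ h => h.1 rfl⟩

theorem conflictGraph_adj {r s : Clause α} :
    (conflictGraph α).Adj r s ↔ r ≠ s ∧ (r.head ∈ s.neg ∨ s.head ∈ r.neg) :=
  Iff.rfl

instance [DecidableEq α] : DecidableRel (conflictGraph α).Adj := fun _ _ =>
  decidable_of_iff _ conflictGraph_adj.symm

theorem IsStableModel.not_adj {P : Program α} {M : Set α} (hM : IsStableModel P M) :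
    ∀ r ∈ generating P M, ∀ s ∈ generating P M, ¬ (conflictGraph α).Adj r s := by
  rintro r hr s hs ⟨-, h | h⟩
  · exact (mem_generating.1 hs).2.2 _ h ((hM.mem_iff _).2 ⟨r, hr, rfl⟩)
  · exact (mem_generating.1 hr).2.2 _ h ((hM.mem_iff _).2 ⟨s, hs, rfl⟩)

/-- By minimality of `N` it is enough that `M ∩ N` is a model of the reduct with respect to `N`. A
clause that fires there is applied in `N`; if `M` blocked it, the blocking atom would be the head of
a clause applied in `M`, giving a conflict. -/
theorem IsStableModel.subset_of_not_adj {P : Program α} {M N : Set α} (hM : IsStableModel P M)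
    (hN : IsStableModel P N)
    (h : ∀ r ∈ generating P M, ∀ s ∈ generating P N, ¬ (conflictGraph α).Adj r s) : N ⊆ M := by
  refine (hN.2 (isModel_reduct.2 fun r hr hneg hpos => ?_ : IsModel _ (M ∩ N))).trans
    Set.inter_subset_left
  have hrN : r ∈ generating P N := mem_generating.2 ⟨hr, fun b hb => (hpos b hb).2, hneg⟩
  refine ⟨?_, (hN.mem_iff _).2 ⟨r, hrN, rfl⟩⟩
  refine isModel_reduct.1 hM.1 r hr (fun c hc hcM => ?_) fun b hb => (hpos b hb).1
  obtain ⟨s, hs, rfl⟩ := (hM.mem_iff c).1 hcM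
  -- The graph has no loops, so a clause negating its own head needs a separate argument.
  by_cases hsr : s = r
  · subst hsr
    exact (mem_generating.1 hs).2.2 _ hc hcM
  · exact h s hs r hrN ⟨hsr, Or.inl hc⟩

theorem IsStableModel.eq_of_generating_subset {P I : Program α} {M N : Set α}
    (hM : IsStableModel P M) (hN : IsStableModel P N)
    (hI : ∀ r ∈ I, ∀ s ∈ I, ¬ (conflictGraph α).Adj r s)
    (hMI : generating P M ⊆ I) (hNI : generating P N ⊆ I) : M = N :=
  (hN.subset_of_not_adj hM fun r hr s hs => hI r (hNI hr) s (hMI hs)).antisymm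
    (hM.subset_of_not_adj hN fun r hr s hs => hI r (hMI hr) s (hNI hs))

variable [DecidableEq α]

theorem IsStableModel.exists_isMaxIndep {P : Program α} {M : Set α} (hM : IsStableModel P M) :
    ∃ I, IsMaxIndep (conflictGraph α) P I ∧ generating P M ⊆ I :=
  exists_isMaxIndep_superset (generating_subset P M) hM.not_adj

/-- A program has at most as many stable models as its conflict graph has maximal independent
sets; in case of equality every maximal independent set contains the set of applied clauses of a
stable model, which is contained in no other maximal independent set. -/
theorem numStable_le_card_maxIndeps (P : Program α) :
    numStable P ≤ (maxIndeps (conflictGraph α) P).card ∧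
      (numStable P = (maxIndeps (conflictGraph α) P).card →
        ∀ I, IsMaxIndep (conflictGraph α) P I → ∃ M, IsStableModel P M ∧ generating P M ⊆ I ∧
          ∀ J, IsMaxIndep (conflictGraph α) P J → generating P M ⊆ J → J = I) := by
  choose! f hf hsub using
    fun (M : Set α) (hM : IsStableModel P M) => hM.exists_isMaxIndep
  have hinj : Set.InjOn f (stableModels P) := fun M hM N hN h =>
    hM.eq_of_generating_subset hN (hf M hM).2.1 (hsub M hM) (h ▸ hsub N hN)
  have hcard : (f '' stableModels P).ncard = numStable P := hinj.ncard_image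
  have himg : f '' stableModels P ⊆ (maxIndeps (conflictGraph α) P : Set (Finset (Clause α))) := by
    rintro _ ⟨M, hM, rfl⟩
    exact Finset.mem_coe.2 (mem_maxIndeps.2 (hf M hM))
  constructor
  · rw [← hcard, ← Set.ncard_coe_finset]
    exact Set.ncard_le_ncard himg (Finset.finite_toSet _)
  · intro h I hI
    -- Equal finite cardinalities make the injection surjective, which also yields uniqueness of the
    -- maximal independent set.
    have := Set.eq_of_subset_of_ncard_le himg
      (by rw [Set.ncard_coe_finset, hcard, h]) (Finset.finite_toSet _)
    obtain ⟨M, hM, rfl⟩ := this.ge (Finset.mem_coe.2 (mem_maxIndeps.2 hI))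
    refine ⟨M, hM, hsub M hM, fun J hJ hMJ => ?_⟩
    obtain ⟨N, hN, rfl⟩ := this.ge (Finset.mem_coe.2 (mem_maxIndeps.2 hJ))
    rw [hM.eq_of_generating_subset hN hJ.2.1 hMJ (hsub N hN)]

theorem numStable_le_moonMoser (P : Program α) : numStable P ≤ moonMoser P.card :=
  (numStable_le_card_maxIndeps P).1.trans (card_maxIndeps_le P)

end StableModels

/-! ### Rigidity of tight programs -/

section Extremal

variable {α : Type*} [DecidableEq α]

/-- The conflict graph of `P` is a disjoint union of complete graphs with at least two vertices,
and each of its maximal independent sets is the set of applied clauses of a stable model. -/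
structure IsTight (P : Program α) : Prop where
  trans : ∀ r ∈ P, ∀ s ∈ P, ∀ t ∈ P, (conflictGraph α).Adj r s → (conflictGraph α).Adj s t →
    r ≠ t → (conflictGraph α).Adj r t
  exists_adj : ∀ r ∈ P, ∃ s ∈ P, (conflictGraph α).Adj r s
  exists_stable : ∀ I, IsMaxIndep (conflictGraph α) P I →
    ∃ M, IsStableModel P M ∧ generating P M = I

/-- In a disjoint union of complete graphs, a vertex of a maximal independent set may be replaced
by any of its neighbours. -/
theorem IsMaxIndep.swap {V : Type*} [DecidableEq V] {G : SimpleGraph V} {W I : Finset V}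
    (htrans : ∀ r ∈ W, ∀ s ∈ W, ∀ t ∈ W, G.Adj r s → G.Adj s t → r ≠ t → G.Adj r t)
    (hI : IsMaxIndep G W I) {r s : V} (hr : r ∈ I) (hs : s ∈ W) (hrs : G.Adj r s) :
    IsMaxIndep G W (insert s (I.erase r)) := by
  obtain ⟨hIW, hind, hmax⟩ := hI
  have key : ∀ x ∈ I.erase r, ¬ G.Adj s x := by
    intro x hx hsx
    rw [Finset.mem_erase] at hx
    exact hind r hr x hx.2 (htrans r (hIW hr) s hs x (hIW hx.2) hrs hsx hx.1.symm)
  refine ⟨Finset.insert_subset hs ((Finset.erase_subset _ _).trans hIW), ?_, ?_⟩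
  · intro x hx y hy
    rcases Finset.mem_insert.1 hx with rfl | hx' <;> rcases Finset.mem_insert.1 hy with rfl | hy'
    · exact G.irrefl
    · exact key y hy'
    · exact fun h => key x hx' h.symm
    · exact hind x (Finset.mem_of_mem_erase hx') y (Finset.mem_of_mem_erase hy')
  · intro x hx hxI
    rw [Finset.mem_insert, Finset.mem_erase, not_or] at hxI
    by_cases hxr : x = r
    · exact ⟨s, Finset.mem_insert_self _ _, hxr ▸ hrs⟩
    · obtain ⟨y, hy, hxy⟩ := hmax x hx fun h => hxI.2 ⟨hxr, h⟩
      by_cases hyr : y = r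
      · subst hyr
        exact ⟨s, Finset.mem_insert_self _ _, htrans x hx y (hIW hr) s hs hxy hrs hxI.1⟩
      · exact ⟨y, Finset.mem_insert_of_mem (Finset.mem_erase.2 ⟨hyr, hy⟩), hxy⟩

theorem exists_isMaxIndep_mem {V : Type*} [DecidableEq V] {G : SimpleGraph V} {W : Finset V}
    {r : V} (hr : r ∈ W) : ∃ I, IsMaxIndep G W I ∧ r ∈ I := by
  obtain ⟨I, hI, hsub⟩ := exists_isMaxIndep_superset (G := G) (W := W) (I := {r})
    (by simpa using hr) (by simp)
  exact ⟨I, hI, hsub (by simp)⟩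

namespace IsTight

variable {P : Program α}

theorem head_notMem_neg (hP : IsTight P) {r : Clause α} (hr : r ∈ P) : r.head ∉ r.neg := by
  obtain ⟨I, hI, hrI⟩ := exists_isMaxIndep_mem (G := conflictGraph α) hr
  obtain ⟨M, hM, rfl⟩ := hP.exists_stable I hI
  exact fun h => (mem_generating.1 hrI).2.2 _ h ((hM.mem_iff _).2 ⟨r, hrI, rfl⟩)

/-- Two clauses that can be exchanged in a maximal independent set without producing a new head
coincide. -/
theorem false_of_swap (hP : IsTight P) {I : Program α} (hI : IsMaxIndep (conflictGraph α) P I)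
    {r s : Clause α} (hr : r ∈ I) (hs : s ∈ P) (hrs : (conflictGraph α).Adj r s)
    (hhead : ∃ t ∈ I, t.head = s.head) : False := by
  obtain ⟨M, hM, hMI⟩ := hP.exists_stable I hI
  obtain ⟨N, hN, hNI⟩ := hP.exists_stable _ (hI.swap hP.trans hr hs hrs)
  -- The exchange produces no new atom, so the two stable models are nested, hence equal; their
  -- applied clauses would then include both `r` and `s`.
  have hNM : N ⊆ M := by
    intro a ha
    obtain ⟨t, ht, rfl⟩ := (hN.mem_iff a).1 ha
    rw [hNI, Finset.mem_insert] at ht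
    rw [hM.mem_iff, hMI]
    rcases ht with rfl | ht
    · exact hhead
    · exact ⟨t, Finset.mem_of_mem_erase ht, rfl⟩
  have hMN := hM.eq_of_subset hN hNM
  subst hMN
  have hsI : s ∈ I := by
    rw [← hMI, hNI]
    exact Finset.mem_insert_self _ _
  exact hI.2.1 r hr s hsI hrs

/-- If two clauses with the same head conflict, exchange one for the other. If not, a neighbour `t`
of `s` is compatible with `r`, and exchanging `t` for `s` in the presence of `r` adds no new head.
-/
theorem head_injOn (hP : IsTight P) : Set.InjOn Clause.head (P : Set (Clause α)) := by
  intro r hr s hs hrs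
  rw [Finset.mem_coe] at hr hs
  by_contra hne
  by_cases hadj : (conflictGraph α).Adj r s
  · obtain ⟨I, hI, hrI⟩ := exists_isMaxIndep_mem (G := conflictGraph α) hr
    exact hP.false_of_swap hI hrI hs hadj ⟨r, hrI, hrs⟩
  · obtain ⟨t, ht, hst⟩ := hP.exists_adj s hs
    have hrt : ¬ (conflictGraph α).Adj r t := fun h =>
      hadj (hP.trans r hr t ht s hs h hst.symm hne)
    obtain ⟨I, hI, hsub⟩ := exists_isMaxIndep_superset (G := conflictGraph α) (W := P)
      (I := {r, t}) (by simp [Finset.insert_subset_iff, hr, ht])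
      (by simp [hrt, SimpleGraph.adj_comm _ t r])
    exact hP.false_of_swap hI (hsub (by simp)) hs hst.symm ⟨r, hsub (by simp), hrs⟩

/-- Only one clause `t` can derive `b`. If `t` is `r`, the derivation is circular; otherwise
exchanging `t` for a neighbour destroys `b`, although `r` must stay applied. -/
theorem pos_eq_empty (hP : IsTight P) {r : Clause α} (hr : r ∈ P) : r.pos = ∅ := by
  rw [Finset.eq_empty_iff_forall_notMem]
  intro b hb
  obtain ⟨I, hI, hrI⟩ := exists_isMaxIndep_mem (G := conflictGraph α) hr
  obtain ⟨M, hM, hMI⟩ := hP.exists_stable I hI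
  have hbM : b ∈ M := (mem_generating.1 (hMI ▸ hrI)).2.1 b hb
  obtain ⟨t, htI, rfl⟩ := (hM.mem_iff b).1 hbM
  rw [hMI] at htI
  have htP : t ∈ P := hI.1 htI
  by_cases htr : t = r
  · subst htr
    have hsub : M ⊆ M \ {t.head} := by
      refine hM.2 (isModel_reduct.2 fun q hq hneg hpos => ?_)
      refine ⟨isModel_reduct.1 hM.1 q hq hneg fun c hc => (hpos c hc).1, fun hqt => ?_⟩
      obtain rfl : q = t := hP.head_injOn hq htP hqt
      exact (hpos _ hb).2 rfl
    exact (hsub hbM).2 rfl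
  · obtain ⟨s, hs, hts⟩ := hP.exists_adj t htP
    obtain ⟨N, hN, hNI⟩ := hP.exists_stable _ (hI.swap hP.trans htI hs hts)
    have hrN : r ∈ generating P N := by
      rw [hNI]
      exact Finset.mem_insert_of_mem (Finset.mem_erase.2 ⟨Ne.symm htr, hrI⟩)
    obtain ⟨q, hqN, hqt⟩ := (hN.mem_iff _).1 ((mem_generating.1 hrN).2.1 _ hb)
    obtain rfl : q = t := hP.head_injOn (generating_subset P N hqN) htP hqt
    rw [hNI, Finset.mem_insert] at hqN
    rcases hqN with h | h
    · exact hts.ne h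
    · exact Finset.notMem_erase _ _ h

/-- Conflicts turn out to be mutual. When `s` is applied, its neighbour `r` is not, and with an
empty positive body it must be blocked by the head of some applied `t`; then `t` lies in the clique
of `s`, so `t = s`. -/
theorem head_mem_neg_iff (hP : IsTight P) {r s : Clause α} (hr : r ∈ P) (hs : s ∈ P) :
    s.head ∈ r.neg ↔ (conflictGraph α).Adj r s := by
  constructor
  · intro h
    refine ⟨?_, Or.inr h⟩
    rintro rfl
    exact hP.head_notMem_neg hr h
  · intro hrs
    obtain ⟨I, hI, hsI⟩ := exists_isMaxIndep_mem (G := conflictGraph α) hs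
    obtain ⟨M, hM, hMI⟩ := hP.exists_stable I hI
    have hrI : r ∉ I := fun h => hI.2.1 r h s hsI hrs
    have hrM : r ∉ generating P M := hMI ▸ hrI
    simp only [mem_generating, hr, hP.pos_eq_empty hr, true_and, Finset.notMem_empty,
      false_imp_iff, implies_true, not_forall, not_not] at hrM
    obtain ⟨c, hc, hcM⟩ := hrM
    obtain ⟨t, ht, rfl⟩ := (hM.mem_iff c).1 hcM
    rw [hMI] at ht
    by_cases hts : t = s
    · exact hts ▸ hc
    · have htr : (conflictGraph α).Adj t r := ⟨fun h => hrI (h ▸ ht), Or.inl hc⟩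
      exact absurd (hP.trans t (hI.1 ht) r hr s hs htr hrs hts) (hI.2.1 t ht s hsI)

end IsTight

/-- A program with the maximum number of stable models is tight. -/
theorem isTight_of_numStable_eq {P : Program α} {S : Finset (Program α)}
    (hS : IsClusterFamily (conflictGraph α) P S) (hS2 : ∀ A ∈ S, 2 ≤ A.card)
    (h : numStable P = (maxIndeps (conflictGraph α) P).card) : IsTight P := by
  have htrans : ∀ r ∈ P, ∀ s ∈ P, ∀ t ∈ P, (conflictGraph α).Adj r s →
      (conflictGraph α).Adj s t → r ≠ t → (conflictGraph α).Adj r t := by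
    intro r hr s hs t ht hrs hst hrt
    obtain ⟨-, A, hA, hrA, hsA⟩ := (hS.adj_iff r hr s hs).1 hrs
    obtain ⟨-, B, hB, hsB, htB⟩ := (hS.adj_iff s hs t ht).1 hst
    obtain rfl : A = B := by
      by_contra hAB
      exact Finset.disjoint_left.1 (hS.disj A hA B hB hAB) hsA hsB
    exact (hS.adj_iff r hr t ht).2 ⟨hrt, A, hA, hrA, htB⟩
  have hex : ∀ r ∈ P, ∃ s ∈ P, (conflictGraph α).Adj r s := by
    intro r hr
    obtain ⟨A, hA, hrA⟩ := (hS.mem_iff r).1 hr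
    obtain ⟨s, hsA, hsr⟩ := Finset.exists_mem_ne (hS2 A hA) r
    have hs : s ∈ P := (hS.mem_iff s).2 ⟨A, hA, hsA⟩
    exact ⟨s, hs, (hS.adj_iff r hr s hs).2 ⟨hsr.symm, A, hA, hrA, hsA⟩⟩
  refine ⟨htrans, hex, fun I hI => ?_⟩
  obtain ⟨M, hM, hMI, huniq⟩ := (numStable_le_card_maxIndeps P).2 h I hI
  refine ⟨M, hM, hMI.antisymm fun r hr => ?_⟩
  by_contra hrM
  -- If `r` were not applied, exchanging it for a neighbour would give a second maximal independent
  -- set around the same applied clauses.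
  obtain ⟨s, hs, hrs⟩ := hex r (hI.1 hr)
  refine hI.2.1 r hr s ?_ hrs
  rw [← huniq _ (hI.swap htrans hr hs hrs) fun t ht => Finset.mem_insert_of_mem
    (Finset.mem_erase.2 ⟨fun htr => hrM (htr ▸ ht), hMI ht⟩)]
  exact Finset.mem_insert_self _ _

end Extremal

/-! ### Counting stable models of canonical programs -/

section Canonical

variable {α : Type*} [DecidableEq α]

theorem mem_canonical {A : Finset α} {r : Clause α} :
    r ∈ canonical A ↔ ∃ a ∈ A, (⟨a, ∅, A.erase a⟩ : Clause α) = r := by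
  simp [canonical]

/-- Every system of representatives of disjoint sets is a stable model of the union of the
canonical programs over these sets. -/
theorem isStableModel_biUnion_canonical {S : Finset (Finset α)}
    (hS : ∀ A ∈ S, ∀ B ∈ S, A ≠ B → Disjoint A B) (f : ∀ A ∈ S, α) (hf : ∀ A hA, f A hA ∈ A) :
    IsStableModel (S.biUnion canonical) {a | ∃ A hA, f A hA = a} := by
  have huniq : ∀ A hA B hB, f B hB ∈ A → f B hB = f A hA := by
    intro A hA B hB h
    obtain rfl : A = B := by
      by_contra hAB
      exact Finset.disjoint_left.1 (hS A hA B hB hAB) h (hf B hB)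
    rfl
  refine isStableModel_iff.2 ⟨isModel_reduct.2 fun r hr hneg _ => ?_, fun N hN => ?_⟩
  · obtain ⟨A, hA, hrA⟩ := Finset.mem_biUnion.1 hr
    obtain ⟨a, ha, rfl⟩ := mem_canonical.1 hrA
    refine ⟨A, hA, ?_⟩
    by_contra hne
    exact hneg _ (Finset.mem_erase.2 ⟨hne, hf A hA⟩) ⟨A, hA, rfl⟩
  · rintro _ ⟨A, hA, rfl⟩
    refine isModel_reduct.1 hN ⟨f A hA, ∅, A.erase (f A hA)⟩ ?_ ?_ (by simp)
    · exact Finset.mem_biUnion.2 ⟨A, hA, mem_canonical.2 ⟨_, hf A hA, rfl⟩⟩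
    · rintro c hc ⟨B, hB, rfl⟩
      rw [Finset.mem_erase] at hc
      exact hc.1 (huniq A hA B hB hc.2)

/-- Since the blocks are disjoint, a choice function can be read off from its set of values, so
different choices give different stable models. -/
theorem prod_card_le_numStable {S : Finset (Finset α)}
    (hS : ∀ A ∈ S, ∀ B ∈ S, A ≠ B → Disjoint A B) :
    ∏ A ∈ S, A.card ≤ numStable (S.biUnion canonical) := by
  have hcard := Finset.card_pi S (fun A => A)
  rw [← hcard, ← Set.ncard_coe_finset]
  refine Set.ncard_le_ncard_of_injOn (fun f => {a | ∃ A hA, f A hA = a}) ?_ ?_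
    (finite_stableModels _)
  · intro f hf
    exact isStableModel_biUnion_canonical hS f (Finset.mem_pi.1 (Finset.mem_coe.1 hf))
  · intro f hf g hg hfg
    have hf' := Finset.mem_pi.1 (Finset.mem_coe.1 hf)
    have hg' := Finset.mem_pi.1 (Finset.mem_coe.1 hg)
    funext A hA
    have hmem : f A hA ∈ {a | ∃ A hA, g A hA = a} := by
      rw [← show {a | ∃ A hA, f A hA = a} = {a | ∃ A hA, g A hA = a} from hfg]
      exact ⟨A, hA, rfl⟩
    obtain ⟨B, hB, hBA⟩ := hmem
    obtain rfl : A = B := by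
      by_contra hAB
      exact Finset.disjoint_left.1 (hS A hA B hB hAB) (hf' A hA) (hBA ▸ hg' B hB)
    exact hBA.symm

theorem card_biUnion_canonical_le (S : Finset (Finset α)) :
    (S.biUnion canonical).card ≤ ∑ A ∈ S, A.card :=
  Finset.card_biUnion_le.trans (Finset.sum_le_sum fun _ _ => Finset.card_image_le)

theorem exists_disjoint_card_eq [Infinite α] (F : Finset α) (n : ℕ) :
    ∃ A : Finset α, A.card = n ∧ Disjoint A F := by
  obtain ⟨t, hFt, ht⟩ := Infinite.exists_superset_card_eq F (F.card + n) (by omega)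
  exact ⟨t \ F, by rw [Finset.card_sdiff_of_subset hFt, ht]; omega, Finset.sdiff_disjoint⟩

/-- The recursion of `moonMoser` is matched by adding a fresh block of three atoms, available
because there are infinitely many. -/
theorem exists_family_prod_card_eq [Infinite α] : ∀ n, 2 ≤ n →
    ∃ S : Finset (Finset α), (∀ A ∈ S, ∀ B ∈ S, A ≠ B → Disjoint A B) ∧
      ∑ A ∈ S, A.card = n ∧ ∏ A ∈ S, A.card = moonMoser n
  | 0, h | 1, h => by omega
  | 2, _ | 3, _ | 4, _ => by
    obtain ⟨A, hA, -⟩ := exists_disjoint_card_eq (∅ : Finset α) _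
    exact ⟨{A}, by simp +contextual, by simpa using hA, by simp [hA, moonMoser]⟩
  | n + 5, _ => by
    obtain ⟨S, hS, hsum, hprod⟩ := exists_family_prod_card_eq (n + 2) (by omega)
    obtain ⟨A, hA, hAF⟩ := exists_disjoint_card_eq (S.biUnion id) 3
    have hd : ∀ B ∈ S, Disjoint A B := fun B hB =>
      hAF.mono_right (Finset.subset_biUnion_of_mem id hB)
    have hAS : A ∉ S := fun h => by
      have := disjoint_self.1 (hd A h)
      rw [this] at hA
      simp at hA
    refine ⟨insert A S, ?_, ?_, ?_⟩
    · intro B hB C hC hBC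
      rcases Finset.mem_insert.1 hB with rfl | hB' <;> rcases Finset.mem_insert.1 hC with rfl | hC'
      · exact absurd rfl hBC
      · exact hd C hC'
      · exact (hd B hB').symm
      · exact hS B hB' C hC' hBC
    · rw [Finset.sum_insert hAS, hsum, hA]; ring
    · rw [Finset.prod_insert hAS, hprod, hA, moonMoser]

end Canonical

/-! ### Redundant negated atoms and signatures -/

section Overline

variable {α : Type*} [DecidableEq α]

theorem mem_heads {P : Program α} {a : α} : a ∈ heads P ↔ ∃ r ∈ P, r.head = a := by
  simp [heads]

theorem mem_atoms {P : Program α} {a : α} :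
    a ∈ atoms P ↔ ∃ r ∈ P, a = r.head ∨ a ∈ r.pos ∨ a ∈ r.neg := by
  simp [atoms]

theorem heads_overline (P : Program α) : heads (overline P) = heads P := by
  simp only [heads, overline, Finset.image_image]
  rfl

theorem IsStableModel.subset_heads {P : Program α} {M : Set α} (hM : IsStableModel P M) :
    M ⊆ heads P := by
  intro a ha
  obtain ⟨r, hr, rfl⟩ := (hM.mem_iff a).1 ha
  exact Finset.mem_coe.2 (mem_heads.2 ⟨r, generating_subset P M hr, rfl⟩)

/-- A set of heads contains no redundant atom, so the deleted negative literals never remove a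
clause from the reduct. -/
theorem isModel_reduct_overline {P : Program α} {M : Set α} (hM : M ⊆ heads P) (N : Set α) :
    IsModel (reduct (overline P) M) N ↔ IsModel (reduct P M) N := by
  rw [isModel_reduct, isModel_reduct, overline, Finset.forall_mem_image]
  refine forall₂_congr fun r hr => imp_congr_left ⟨fun h c hc hcM => ?_, fun h c hc => ?_⟩
  · refine h c (Finset.mem_sdiff.2 ⟨hc, fun hred => ?_⟩) hcM
    exact (Finset.mem_sdiff.1 hred).2 (Finset.mem_coe.1 (hM hcM))
  · exact h c (Finset.mem_sdiff.1 hc).1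

theorem isStableModel_overline {P : Program α} {M : Set α} :
    IsStableModel (overline P) M ↔ IsStableModel P M := by
  constructor
  · intro h
    have hM := h.subset_heads
    rw [heads_overline] at hM
    simpa only [isStableModel_iff, isModel_reduct_overline hM] using h
  · intro h
    simpa only [isStableModel_iff, isModel_reduct_overline h.subset_heads] using h

theorem numStable_overline (P : Program α) : numStable (overline P) = numStable P := by
  simp only [numStable, stableModels, isStableModel_overline]

theorem sum_and_prod_card {V : Type*} (S : Finset (Finset V))
    (hS : ∀ A ∈ S, 2 ≤ A.card ∧ A.card ≤ 4) :
    ∑ A ∈ S, A.card = 2 * (S.filter fun A => A.card = 2).card +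
      3 * (S.filter fun A => A.card = 3).card + 4 * (S.filter fun A => A.card = 4).card ∧
    ∏ A ∈ S, A.card = 2 ^ (S.filter fun A => A.card = 2).card *
      3 ^ (S.filter fun A => A.card = 3).card * 4 ^ (S.filter fun A => A.card = 4).card := by
  classical
  induction S using Finset.induction_on with
  | empty => simp
  | insert A S hA ih =>
    obtain ⟨ih1, ih2⟩ := ih fun B hB => hS B (Finset.mem_insert_of_mem hB)
    obtain ⟨h2, h4⟩ := hS A (Finset.mem_insert_self _ _)
    rw [Finset.sum_insert hA, Finset.prod_insert hA, ih1, ih2]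
    simp only [Finset.filter_insert]
    have hcases : A.card = 2 ∨ A.card = 3 ∨ A.card = 4 := by omega
    have hn : ∀ i, A ∉ S.filter fun A => A.card = i := fun i h => hA (Finset.mem_filter.1 h).1
    rcases hcases with h | h | h <;> simp [h, hn] <;> constructor <;> ring

theorem HasSignature.le_numStable {P : Program α} {a b c : ℕ} (h : HasSignature (overline P) a b c) :
    2 ^ a * 3 ^ b * 4 ^ c ≤ numStable P := by
  obtain ⟨S, hS, hP, rfl, rfl, rfl⟩ := h
  rw [← (sum_and_prod_card S.parts hS).2, ← numStable_overline]
  refine le_of_le_of_eq ?_ (congrArg numStable hP).symm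
  exact prod_card_le_numStable fun A hA B hB hAB => S.disjoint hA hB hAB

/-- By `head_mem_neg_iff`, the heads negated in `r` are those of its neighbours, that is, of the
rest of its clique; all other negated atoms are redundant. -/
theorem IsTight.overline_clause {P : Program α} (hP : IsTight P) {S : Finset (Program α)}
    (hS : IsClusterFamily (conflictGraph α) P S) {A : Program α} (hA : A ∈ S) {r : Clause α}
    (hr : r ∈ A) :
    (⟨r.head, r.pos, r.neg \ redundantAtoms P⟩ : Clause α) =
      ⟨r.head, ∅, (A.image Clause.head).erase r.head⟩ := by
  have hAP : ∀ s ∈ A, s ∈ P := fun s hs => (hS.mem_iff s).2 ⟨A, hA, hs⟩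
  have hrP := hAP r hr
  rw [hP.pos_eq_empty hrP]
  congr 1
  ext a
  simp only [Finset.mem_sdiff, redundantAtoms, Finset.mem_erase, Finset.mem_image, not_and, not_not]
  constructor
  · rintro ⟨ha, h⟩
    obtain ⟨s, hs, rfl⟩ := mem_heads.1 (h (mem_atoms.2 ⟨r, hrP, Or.inr (Or.inr ha)⟩))
    have hadj := (hP.head_mem_neg_iff hrP hs).1 ha
    obtain ⟨-, B, hB, hrB, hsB⟩ := (hS.adj_iff r hrP s hs).1 hadj
    obtain rfl : A = B := by
      by_contra hAB
      exact Finset.disjoint_left.1 (hS.disj A hA B hB hAB) hr hrB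
    exact ⟨fun h => hadj.ne (hP.head_injOn hs hrP h).symm, s, hsB, rfl⟩
  · rintro ⟨hne, s, hs, rfl⟩
    refine ⟨(hP.head_mem_neg_iff hrP (hAP s hs)).2 ((hS.adj_iff r hrP s (hAP s hs)).2 ⟨?_, A, hA,
      hr, hs⟩), fun _ => mem_heads.2 ⟨s, hAP s hs, rfl⟩⟩
    rintro rfl
    exact hne rfl

/-- The parts are the head sets of the cliques; injectivity of heads keeps them disjoint and
preserves their sizes. -/
theorem IsTight.hasSignature_overline {P : Program α} (hP : IsTight P) {S : Finset (Program α)}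
    (hS : IsClusterFamily (conflictGraph α) P S) (hS2 : ∀ A ∈ S, 2 ≤ A.card ∧ A.card ≤ 4) :
    HasSignature (overline P) (S.filter fun A => A.card = 2).card
      (S.filter fun A => A.card = 3).card (S.filter fun A => A.card = 4).card := by
  have hAP : ∀ A ∈ S, A ⊆ P := fun A hA r hr => (hS.mem_iff r).2 ⟨A, hA, hr⟩
  have hcard : ∀ A ∈ S, (A.image Clause.head).card = A.card := fun A hA =>
    Finset.card_image_of_injOn (hP.head_injOn.mono (Finset.coe_subset.2 (hAP A hA)))
  have hdisj : ∀ A ∈ S, ∀ B ∈ S, A ≠ B →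
      Disjoint (A.image Clause.head) (B.image Clause.head) := by
    intro A hA B hB hAB
    rw [Finset.disjoint_left]
    intro a haA haB
    obtain ⟨r, hr, rfl⟩ := Finset.mem_image.1 haA
    obtain ⟨s, hs, hsr⟩ := Finset.mem_image.1 haB
    obtain rfl := hP.head_injOn (hAP B hB hs) (hAP A hA hr) hsr
    exact Finset.disjoint_left.1 (hS.disj A hA B hB hAB) hr hs
  have hinj : Set.InjOn (fun A : Program α => A.image Clause.head) S := by
    intro A hA B hB hAB
    by_contra hne
    have h0 := hdisj A hA B hB hne
    rw [show A.image Clause.head = B.image Clause.head from hAB, disjoint_self] at h0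
    have h2 := (hS2 B hB).1
    rw [← hcard B hB, h0] at h2
    simp at h2
  have hover : overline P = (S.image fun A => A.image Clause.head).biUnion canonical := by
    ext q
    simp only [overline, Finset.mem_image, Finset.mem_biUnion, mem_canonical, exists_exists_and_eq_and]
    constructor
    · rintro ⟨r, hr, rfl⟩
      obtain ⟨A, hA, hrA⟩ := (hS.mem_iff r).1 hr
      exact ⟨A, hA, r, hrA, (hP.overline_clause hS hA hrA).symm⟩
    · rintro ⟨A, hA, r, hr, rfl⟩
      exact ⟨r, hAP A hA hr, hP.overline_clause hS hA hr⟩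
  have hatoms : (S.image fun A => A.image Clause.head).sup id = atoms (overline P) := by
    ext a
    rw [hover, mem_atoms]
    simp only [Finset.mem_sup, Finset.mem_image, Finset.mem_biUnion, mem_canonical, id,
      exists_exists_and_eq_and]
    constructor
    · rintro ⟨A, hA, r, hr, rfl⟩
      exact ⟨_, ⟨A, hA, r, hr, rfl⟩, Or.inl rfl⟩
    · rintro ⟨q, ⟨A, hA, r, hr, rfl⟩, h | h | h⟩
      · exact ⟨A, hA, r, hr, h.symm⟩
      · simp at h
      · exact ⟨A, hA, Finset.mem_image.1 (Finset.mem_of_mem_erase h)⟩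
  have hfilter : ∀ i, ((S.image fun A => A.image Clause.head).filter fun A => A.card = i).card =
      (S.filter fun A => A.card = i).card := by
    intro i
    rw [Finset.filter_image, Finset.card_image_of_injOn
      (hinj.mono (Finset.coe_subset.2 (Finset.filter_subset _ _)))]
    congr 1
    exact Finset.filter_congr fun A hA => by rw [hcard A hA]
  refine ⟨⟨S.image fun A => A.image Clause.head, ?_, hatoms, ?_⟩, ?_, hover,
    hfilter 2, hfilter 3, hfilter 4⟩
  · rw [Finset.supIndep_iff_pairwiseDisjoint]
    intro A hA B hB hAB
    obtain ⟨A, hA', rfl⟩ := Finset.mem_image.1 (Finset.mem_coe.1 hA)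
    obtain ⟨B, hB', rfl⟩ := Finset.mem_image.1 (Finset.mem_coe.1 hB)
    exact hdisj A hA' B hB' fun h => hAB (by rw [h])
  · intro h
    obtain ⟨A, hA, h⟩ := Finset.mem_image.1 h
    have h2 := (hS2 A hA).1
    rw [← hcard A hA, h] at h2
    simp at h2
  · intro B hB
    obtain ⟨A, hA, rfl⟩ := Finset.mem_image.1 hB
    rw [hcard A hA]
    exact hS2 A hA

end Overline

/-! ### Extremal programs and asymptotics -/

section Main

variable {α : Type*} [DecidableEq α]

theorem IsClusterFamily.sum_card {V : Type*} [DecidableEq V] {G : SimpleGraph V} {W : Finset V}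
    {S : Finset (Finset V)} (hS : IsClusterFamily G W S) : ∑ A ∈ S, A.card = W.card := by
  have hW : W = S.biUnion id := by
    ext x
    simpa using hS.mem_iff x
  rw [hW, Finset.card_biUnion (t := id) fun A hA B hB hAB => hS.disj A hA B hB hAB]
  rfl

theorem mem_classE_of_moonMoser_le {n : ℕ} (hn : 2 ≤ n) {P : Program α} (hP : P.card ≤ n)
    (h : moonMoser n ≤ numStable P) : P ∈ classE α n := by
  have hle := numStable_le_moonMoser P
  -- With fewer than `n` clauses, strict monotonicity would put the bound below `moonMoser n`.
  obtain rfl : P.card = n := by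
    by_contra hne
    exact absurd (h.trans hle) (not_le.2 (moonMoser_lt (by omega) hn))
  have h1 := card_maxIndeps_le (G := conflictGraph α) P
  have h2 := (numStable_le_card_maxIndeps P).1
  obtain ⟨S, hS, hS2, hprod⟩ := exists_isClusterFamily_of_card_maxIndeps_eq
    (G := conflictGraph α) P (by omega) (by omega)
  have hsig := (isTight_of_numStable_eq hS (fun A hA => (hS2 A hA).1)
    (by omega)).hasSignature_overline hS hS2
  obtain ⟨hs, hp⟩ := sum_and_prod_card S hS2
  rw [hS.sum_card] at hs
  rw [hprod] at hp
  generalize (S.filter fun A => A.card = 2).card = a at *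
  generalize (S.filter fun A => A.card = 3).card = b at *
  generalize (S.filter fun A => A.card = 4).card = c at *
  have hac := add_le_two_of_pow_mul_eq (a := a) (b := b) (c := c) (by rw [← hp, hs])
  have hcases : (a = 0 ∧ c = 0) ∨ (a = 1 ∧ c = 0) ∨ (a = 2 ∧ c = 0) ∨ (a = 0 ∧ c = 1) := by omega
  rcases hcases with ⟨rfl, rfl⟩ | ⟨rfl, rfl⟩ | ⟨rfl, rfl⟩ | ⟨rfl, rfl⟩
  · exact Or.inl ⟨b, by omega, by omega, hsig⟩
  · exact Or.inr (Or.inl ⟨b, by omega, hsig⟩)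
  · exact Or.inr (Or.inr ⟨b + 1, by omega, by omega, Or.inl hsig⟩)
  · exact Or.inr (Or.inr ⟨b + 1, by omega, by omega, Or.inr hsig⟩)

theorem s0_le_numStable {n : ℕ} {P : Program α} (h : P ∈ classE α n) : s0 n ≤ numStable P := by
  rcases h with ⟨k, hk, rfl, h⟩ | ⟨k, rfl, h⟩ | ⟨k, hk, rfl, h | h⟩ <;>
    refine le_trans (le_of_eq ?_) h.le_numStable
  · have h1 : 3 * k / 3 = k := by omega
    simp [s0, h1]
  · have h0 : (3 * k + 2) % 3 = 2 := by omega
    have h1 : (3 * k + 2) / 3 = k := by omega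
    simp [s0, h0, h1]
  all_goals
    have h0 : (3 * k + 1) % 3 = 1 := by omega
    have h1 : (3 * k + 1) / 3 = k := by omega
    simp only [s0, h0, h1]
    norm_num
  ring

theorem isGreatest_s0 [Infinite α] {n : ℕ} (hn : 2 ≤ n) :
    IsGreatest (numStable '' LP α n) (s0 n) := by
  rw [← moonMoser_eq_s0 n hn]
  have hub : ∀ P ∈ LP α n, numStable P ≤ moonMoser n := fun P hP =>
    (numStable_le_moonMoser P).trans (moonMoser_mono hP)
  obtain ⟨S, hS, hsum, hprod⟩ := exists_family_prod_card_eq (α := α) n hn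
  have hmem : S.biUnion canonical ∈ LP α n := (card_biUnion_canonical_le S).trans hsum.le
  refine ⟨⟨_, hmem, le_antisymm (hub _ hmem) ?_⟩, ?_⟩
  · rw [← hprod]
    exact prod_card_le_numStable hS
  · rintro _ ⟨P, hP, rfl⟩
    exact hub P hP

theorem setOf_isExtremal [Infinite α] {n : ℕ} (hn : 2 ≤ n) :
    {P : Program α | IsExtremal n P} = LP α n ∩ classE α n := by
  obtain ⟨⟨Q, hQ, hQs⟩, hub⟩ := isGreatest_s0 (α := α) hn
  ext P
  constructor
  · rintro ⟨hP, hmax⟩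
    refine ⟨hP, mem_classE_of_moonMoser_le hn hP ?_⟩
    rw [moonMoser_eq_s0 n hn, ← hQs]
    exact hmax Q hQ
  · rintro ⟨hP, hE⟩
    exact ⟨hP, fun R hR => (hub ⟨R, hR, rfl⟩).trans (s0_le_numStable hE)⟩

theorem s0_bounds {n : ℕ} (hn : 2 ≤ n) : 3 ^ (n / 3) ≤ s0 n ∧ s0 n ≤ 2 * 3 ^ (n / 3) := by
  unfold s0
  split_ifs with h0 h1
  · constructor <;> omega
  · obtain ⟨j, hj⟩ : ∃ j, n / 3 = j + 1 := ⟨n / 3 - 1, by omega⟩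
    rw [hj, Nat.add_sub_cancel, pow_succ]
    constructor <;> omega
  · constructor <;> omega

/-- Rounding the exponent `n / 3` down costs a factor of at most 3, and `s0_bounds` costs at most 2.
-/
theorem isTheta_s0 : Asymptotics.IsTheta Filter.atTop
    (fun n : ℕ => (s0 n : ℝ)) (fun n : ℕ => (3 : ℝ) ^ ((n : ℝ) / 3)) := by
  have hlow : ∀ n : ℕ, (3 : ℝ) ^ (n / 3) ≤ (3 : ℝ) ^ ((n : ℝ) / 3) := by
    intro n
    rw [← Real.rpow_natCast]
    exact Real.rpow_le_rpow_of_exponent_le (by norm_num) Nat.cast_div_le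
  have hupp : ∀ n : ℕ, (3 : ℝ) ^ ((n : ℝ) / 3) ≤ 3 * (3 : ℝ) ^ (n / 3) := by
    intro n
    rw [← pow_succ', ← Real.rpow_natCast]
    refine Real.rpow_le_rpow_of_exponent_le (by norm_num) ?_
    rw [div_le_iff₀ (by norm_num)]
    exact_mod_cast (show n ≤ (n / 3 + 1) * 3 by omega)
  constructor
  · refine Asymptotics.IsBigO.of_bound 2 (Filter.eventually_atTop.2 ⟨2, fun n hn => ?_⟩)
    rw [Real.norm_of_nonneg (by positivity), Real.norm_of_nonneg (by positivity)]
    have h : (s0 n : ℝ) ≤ 2 * 3 ^ (n / 3) := by exact_mod_cast (s0_bounds hn).2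
    linarith [hlow n]
  · refine Asymptotics.IsBigO.of_bound 3 (Filter.eventually_atTop.2 ⟨2, fun n hn => ?_⟩)
    rw [Real.norm_of_nonneg (by positivity), Real.norm_of_nonneg (by positivity)]
    have h : (3 : ℝ) ^ (n / 3) ≤ s0 n := by exact_mod_cast (s0_bounds hn).1
    linarith [hupp n]

end Main

end LogicProg

theorem mainTheorem1 {α : Type*} [DecidableEq α] [Infinite α] :
    (∀ n : ℕ, 2 ≤ n →
      IsGreatest (LogicProg.numStable '' LogicProg.LP α n) (LogicProg.s0 n) ∧
      LogicProg.maxStable α n = LogicProg.s0 n ∧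
      {P : LogicProg.Program α | LogicProg.IsExtremal n P} =
        LogicProg.LP α n ∩ LogicProg.classE α n) ∧
    Asymptotics.IsTheta Filter.atTop
      (fun n : ℕ => (LogicProg.maxStable α n : ℝ)) (fun n : ℕ => (3 : ℝ) ^ ((n : ℝ) / 3)) := by
  have hmax : ∀ n, 2 ≤ n → LogicProg.maxStable α n = LogicProg.s0 n := fun n hn =>
    (LogicProg.isGreatest_s0 hn).csSup_eq
  refine ⟨fun n hn => ⟨LogicProg.isGreatest_s0 hn, hmax n hn, LogicProg.setOf_isExtremal hn⟩, ?_⟩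
  refine Filter.EventuallyEq.trans_isTheta (Filter.eventually_atTop.2 ⟨2, fun n hn => ?_⟩)
    LogicProg.isTheta_s0
  simp only [hmax n hn]
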